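/- Let $\Phi_m$ denote the cardinal B-spline of degree $m$ on the knots $0,1,\dots,m+1$: $\Phi_0=\mathbf 1_{[0,1)}$ and $\Phi_m(s)=\frac{s}{m}\Phi_{m-1}(s)+\frac{m+1-s}{m}\Phi_{m-1}(s-1)$ for $m\ge 1$. For an integer $m\ge 0$ and $\theta\in[-\pi,\pi]$ let $$M_m(\theta)=(2-2\cos\theta)^{m+1}\sum_{j\in\mathbb Z}\frac{1}{(\theta+2j\pi)^{2m+2}},$$ where the value at $\theta=0$ is understood as the limit for $\theta\to0$. For integers $0\le k\le p$ define $D_p^k:[-\pi,\pi]\to\mathbb R$ by $$D_p^k(\theta)=(-1)^k(2-2\cos\theta)^kM_{p-k}(\theta).$$ Then $M_0\equiv 1$, and for all integers $0\le k\le p$ the spline $\Phi_{2p+1}$ is of class $C^{2k}$ and, for every $\theta\in[-\pi,\pi]$, $$\partial_s^{2k}\Phi_{2p+1}(p+1)+\sum_{j=1}^{p}\partial_s^{2k}\Phi_{2p+1}(p+1-j)\,\bigl(e^{-\mathrm i j\theta}+e^{\mathrm i j\theta}\bigr)=D_p^k(\theta).$$ More explicitly, $$D_p^k(\theta)=(-1)^k(2-2\cos\theta)^{p+1}\sum_{j\in\mathbb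 Z}\frac{1}{(\theta+2j\pi)^{2(p+1-k)}},$$ with a convergent series for $\theta\ne0$, and with the right-hand side read as its limit for $\theta\to0$ at $\theta=0$. In particular, $D_p^0(0)=1$, $D_p^k(0)=0$ for $k\ge1$, and $$D_p^k(\pi)=(-1)^k2^{2k}M_{p-k}(\pi)=(-1)^k2^{2k+1}\,\frac{2^{2(p+1-k)}-1}{\pi^{2(p+1-k)}}\,\zeta\bigl(2(p+1-k)\bigr),$$ where $\zeta$ is the Riemann zeta function. -/

import Mathlib

open Filter Topology

noncomputable section

/-- The cardinal B-spline `Φ_p` of degree `p` on the knots `0, 1, …, p + 1`: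
`Φ_0` is the indicator function of `[0, 1)`, and for `p ≥ 1`
`Φ_p(s) = (s / p) Φ_{p-1}(s) + ((p + 1 - s) / p) Φ_{p-1}(s - 1)`. -/
def cardinalBSpline : ℕ → ℝ → ℝ
  | 0 => Set.indicator (Set.Ico (0 : ℝ) 1) (fun _ => 1)
  | p + 1 => fun s =>
      s / ((p + 1 : ℕ) : ℝ) * cardinalBSpline p s
        + (((p + 1 : ℕ) : ℝ) + 1 - s) / ((p + 1 : ℕ) : ℝ) * cardinalBSpline p (s - 1)

/-- The expression `(2 - 2 cos θ)^(p+1) ∑_{j ∈ ℤ} (θ + 2 j π)^(-(2p+2))`, meaningful at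
`θ ∈ [-π, π]`, `θ ≠ 0`. -/
def massSymbolExpr (p : ℕ) (θ : ℝ) : ℝ :=
  (2 - 2 * Real.cos θ) ^ (p + 1)
    * ∑' j : ℤ, 1 / (θ + 2 * (j : ℝ) * Real.pi) ^ (2 * p + 2)

open Classical in
/-- The function `M_p` on `[-π, π]`: given by `massSymbolExpr p` away from `0`, and extended to the
removable singularity `θ = 0` by the limit as `θ → 0`.
(Only the values on `[-π, π]` are meaningful.) -/
def massSymbol (p : ℕ) (θ : ℝ) : ℝ :=
  if θ = 0 then limUnder (𝓝[≠] (0 : ℝ)) (massSymbolExpr p) else massSymbolExpr p θ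

/-- The function `D_p^k(θ) = (-1)^k (2 - 2 cos θ)^k M_{p-k}(θ)` on `[-π, π]`, for `0 ≤ k ≤ p`. -/
def penaltySymbol (p k : ℕ) (θ : ℝ) : ℝ :=
  (-1) ^ k * (2 - 2 * Real.cos θ) ^ k * massSymbol (p - k) θ

end

/-! ### Recursion, support and symmetry of the B-splines -/

noncomputable section

/-! The left-hand side is the Fourier symbol `splineSymbol` of the integer samples of the centred
derivative. Two derivatives lower the degree by two and produce a second central difference
(`centeredDeriv_succ_succ`), that is, a factor `-(2 - 2 cos θ)` on the symbol. This reduces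
everything to `k = 0` (`splineSymbol_eq_mul`).

For `k = 0` and `z = e^{iθ}` the symbol is `z^{-(m+1)} P_{2m+1}(z)`, where `P_n(z) = ∑ Φ_n(j) z^j`
is `eulerFrobenius`. By the spline recursion, `z d/dz` sends `P_n / (1-z)^{n+1}` to `(n+1) P_{n+1} /
(1-z)^{n+2}`, while `d/dθ` sends `∑ (θ+2jπ)^{-n}` to `-n ∑ (θ+2jπ)^{-(n+1)}`. So
`eval_eulerFrobenius_div_eq` propagates by differentiation from `n = 1`, which is the classical `∑
(x+j)^{-2} = π²/sin²(πx)`, the derivative of the cotangent expansion.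

The symbol is a finite trigonometric sum, hence continuous, and equals `P_{2m+1}(1) = 1` at `θ = 0`;
this supplies the limit defining `M_m(0)`. -/

lemma cardinalBSpline_succ (p : ℕ) (s : ℝ) :
    cardinalBSpline (p + 1) s = s / ((p : ℝ) + 1) * cardinalBSpline p s
        + ((p : ℝ) + 2 - s) / ((p : ℝ) + 1) * cardinalBSpline p (s - 1) := by
  simp only [cardinalBSpline]
  push_cast
  ring

lemma cardinalBSpline_zero_apply (s : ℝ) :
    cardinalBSpline 0 s = if 0 ≤ s ∧ s < 1 then 1 else 0 := by
  simp [cardinalBSpline, Set.indicator_apply]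

lemma cardinalBSpline_one_apply (s : ℝ) :
    cardinalBSpline 1 s = max 0 (min s (2 - s)) := by
  rw [cardinalBSpline_succ, cardinalBSpline_zero_apply, cardinalBSpline_zero_apply]
  rcases lt_or_ge s 0 with h0 | h0
  · rw [if_neg (by grind), if_neg (by grind), max_eq_left]
    · simp
    · exact (min_le_left _ _).trans h0.le
  rcases lt_or_ge s 1 with h1 | h1
  · rw [if_pos (by grind), if_neg (by grind), min_eq_left (by linarith), max_eq_right h0]
    simp
  rcases lt_or_ge s 2 with h2 | h2
  · rw [if_neg (by grind), if_pos (by grind), min_eq_right (by linarith),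
      max_eq_right (by linarith)]
    simp
  · rw [if_neg (by grind), if_neg (by grind), max_eq_left]
    · simp
    · exact (min_le_right _ _).trans (by linarith)

lemma continuous_cardinalBSpline_succ (p : ℕ) : Continuous (cardinalBSpline (p + 1)) := by
  induction p with
  | zero =>
    rw [show cardinalBSpline (0 + 1) = fun s => max 0 (min s (2 - s)) from
      funext cardinalBSpline_one_apply]
    fun_prop
  | succ p ih =>
    rw [show cardinalBSpline (p + 1 + 1) = _ from funext (cardinalBSpline_succ (p + 1))]
    fun_prop

lemma cardinalBSpline_eq_zero_of_neg (p : ℕ) {s : ℝ} (hs : s < 0) : cardinalBSpline p s = 0 := by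
  induction p generalizing s with
  | zero => rw [cardinalBSpline_zero_apply, if_neg (by grind)]
  | succ p ih => rw [cardinalBSpline_succ, ih hs, ih (by linarith)]; simp

lemma cardinalBSpline_eq_zero_of_ge (p : ℕ) {s : ℝ} (hs : (p : ℝ) + 1 ≤ s) :
    cardinalBSpline p s = 0 := by
  induction p generalizing s with
  | zero => rw [cardinalBSpline_zero_apply, if_neg (by simp at hs; grind)]
  | succ p ih =>
    push_cast at hs
    rw [cardinalBSpline_succ, ih (by linarith), ih (by linarith)]; simp

lemma cardinalBSpline_succ_zero (p : ℕ) : cardinalBSpline (p + 1) 0 = 0 := by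
  rw [cardinalBSpline_succ, cardinalBSpline_eq_zero_of_neg p (show (0 : ℝ) - 1 < 0 by norm_num)]
  simp

/-- The symmetry starts at degree one: the half-open indicator in degree zero breaks it at the
knots. -/
lemma cardinalBSpline_succ_reflect (p : ℕ) (s : ℝ) :
    cardinalBSpline (p + 1) ((p : ℝ) + 2 - s) = cardinalBSpline (p + 1) s := by
  induction p generalizing s with
  | zero =>
    rw [zero_add, cardinalBSpline_one_apply, cardinalBSpline_one_apply, min_comm]
    norm_num
  | succ p ih =>
    have h1 := ih (s - 1)
    have h2 := ih s
    rw [cardinalBSpline_succ, cardinalBSpline_succ (p + 1) s, ← h1, ← h2]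
    push_cast
    ring_nf

/-- The difference of two neighbouring translates, in terms of the lower degree. -/
lemma cardinalBSpline_succ_sub (p : ℕ) (s : ℝ) :
    ((p : ℝ) + 1) * (cardinalBSpline (p + 1) s - cardinalBSpline (p + 1) (s - 1))
      = s * cardinalBSpline p s + ((p : ℝ) + 3 - 2 * s) * cardinalBSpline p (s - 1)
        - ((p : ℝ) + 3 - s) * cardinalBSpline p (s - 1 - 1) := by
  rw [cardinalBSpline_succ, cardinalBSpline_succ]
  field_simp
  ring

/-! ### Derivatives and smoothness of the B-splines -/

/-- The indicator of `[0, 1)` is constant just to the right of every point, jumps included.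
One-sided derivatives thus allow an induction from degree zero. -/
lemma hasDerivWithinAt_cardinalBSpline_zero (s : ℝ) :
    HasDerivWithinAt (cardinalBSpline 0) 0 (Set.Ioi s) s := by
  refine (hasDerivWithinAt_const s (Set.Ioi s) (cardinalBSpline 0 s)).congr_of_eventuallyEq ?_ rfl
  rcases lt_or_ge s 0 with h0 | h0
  · filter_upwards [mem_nhdsWithin_of_mem_nhds (Iio_mem_nhds h0)] with t ht
    simp only [Set.mem_Iio] at ht
    rw [cardinalBSpline_zero_apply, cardinalBSpline_zero_apply, if_neg (by grind), if_neg (by grind)]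
  rcases lt_or_ge s 1 with h1 | h1
  · filter_upwards [mem_nhdsWithin_of_mem_nhds (Iio_mem_nhds h1), self_mem_nhdsWithin] with t ht h
    simp only [Set.mem_Iio, Set.mem_Ioi] at ht h
    rw [cardinalBSpline_zero_apply, cardinalBSpline_zero_apply, if_pos (by grind), if_pos (by grind)]
  · filter_upwards [self_mem_nhdsWithin] with t ht
    simp only [Set.mem_Ioi] at ht
    rw [cardinalBSpline_zero_apply, cardinalBSpline_zero_apply, if_neg (by grind), if_neg (by grind)]

lemma HasDerivWithinAt.comp_sub_one_Ioi {f : ℝ → ℝ} {f' s : ℝ}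
    (h : HasDerivWithinAt f f' (Set.Ioi (s - 1)) (s - 1)) :
    HasDerivWithinAt (fun t => f (t - 1)) f' (Set.Ioi s) s := by
  have := h.scomp s (((hasDerivAt_id s).sub_const 1).hasDerivWithinAt (s := Set.Ioi s))
    (fun t ht => by simp only [Set.mem_Ioi, id] at *; linarith)
  simpa [Function.comp_def] using this

lemma hasDerivWithinAt_cardinalBSpline_succ (p : ℕ) (s : ℝ) :
    HasDerivWithinAt (cardinalBSpline (p + 1))
      (cardinalBSpline p s - cardinalBSpline p (s - 1)) (Set.Ioi s) s := by
  -- Product rule in the recursion; `cardinalBSpline_succ_sub` later collapses the result to a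
  -- difference.
  have key : ∀ (p : ℕ) (s a b : ℝ), HasDerivWithinAt (cardinalBSpline p) a (Set.Ioi s) s →
      HasDerivWithinAt (cardinalBSpline p) b (Set.Ioi (s - 1)) (s - 1) →
      HasDerivWithinAt (cardinalBSpline (p + 1))
        ((cardinalBSpline p s - cardinalBSpline p (s - 1) + s * a + ((p : ℝ) + 2 - s) * b)
          / ((p : ℝ) + 1)) (Set.Ioi s) s := by
    intro p s a b ha hb
    rw [show cardinalBSpline (p + 1) = _ from funext (cardinalBSpline_succ p)]
    have h1 := (((hasDerivAt_id s).div_const ((p : ℝ) + 1)).hasDerivWithinAt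
      (s := Set.Ioi s)).mul ha
    have h2 := ((((hasDerivAt_id s).const_sub ((p : ℝ) + 2)).div_const
      ((p : ℝ) + 1)).hasDerivWithinAt (s := Set.Ioi s)).mul hb.comp_sub_one_Ioi
    refine (h1.add h2).congr_deriv ?_
    simp only [id]
    field_simp
    ring
  induction p generalizing s with
  | zero =>
    refine (key 0 s 0 0 (hasDerivWithinAt_cardinalBSpline_zero _)
      (hasDerivWithinAt_cardinalBSpline_zero _)).congr_deriv ?_
    simp
  | succ p ih =>
    refine (key (p + 1) s _ _ (ih s) (ih (s - 1))).congr_deriv ?_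
    have := cardinalBSpline_succ_sub p s
    push_cast
    rw [div_eq_iff (by positivity)]
    linear_combination -this

/-- From degree two on the right derivative is continuous, so the spline is its primitive and the
derivative is two-sided. -/
lemma hasDerivAt_cardinalBSpline_add_two (p : ℕ) (s : ℝ) :
    HasDerivAt (cardinalBSpline (p + 2))
      (cardinalBSpline (p + 1) s - cardinalBSpline (p + 1) (s - 1)) s := by
  have hc : Continuous fun t => cardinalBSpline (p + 1) t - cardinalBSpline (p + 1) (t - 1) := by
    have := continuous_cardinalBSpline_succ p
    fun_prop
  have hint : ∀ t ∈ Set.Ioi (s - 1),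
      cardinalBSpline (p + 2) t = cardinalBSpline (p + 2) (s - 1)
        + ∫ y in (s - 1)..t, (cardinalBSpline (p + 1) y - cardinalBSpline (p + 1) (y - 1)) := by
    intro t _
    rw [intervalIntegral.integral_eq_sub_of_hasDeriv_right
      (continuous_cardinalBSpline_succ (p + 1)).continuousOn
      (fun x _ => hasDerivWithinAt_cardinalBSpline_succ (p + 1) x)
      (hc.intervalIntegrable _ _)]
    simp
  refine HasDerivAt.congr_of_eventuallyEq ?_
    (eventuallyEq_of_mem (Ioi_mem_nhds (show s - 1 < s by linarith)) hint)
  exact (intervalIntegral.integral_hasDerivAt_right (hc.intervalIntegrable _ _)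
    hc.stronglyMeasurable.stronglyMeasurableAtFilter hc.continuousAt).const_add _

lemma deriv_cardinalBSpline_add_two (p : ℕ) :
    deriv (cardinalBSpline (p + 2))
      = fun s => cardinalBSpline (p + 1) s - cardinalBSpline (p + 1) (s - 1) :=
  funext fun s => (hasDerivAt_cardinalBSpline_add_two p s).deriv

lemma contDiff_cardinalBSpline_succ (p : ℕ) : ContDiff ℝ p (cardinalBSpline (p + 1)) := by
  induction p with
  | zero => exact contDiff_zero.2 (continuous_cardinalBSpline_succ 0)
  | succ p ih =>
    push_cast
    rw [contDiff_succ_iff_deriv]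
    refine ⟨fun s => (hasDerivAt_cardinalBSpline_add_two p s).differentiableAt, by simp, ?_⟩
    rw [deriv_cardinalBSpline_add_two]
    exact ih.sub (ih.comp (contDiff_id.sub contDiff_const))

lemma contDiff_cardinalBSpline_succ_of_le {n p : ℕ} (h : n ≤ p) :
    ContDiff ℝ n (cardinalBSpline (p + 1)) :=
  (contDiff_cardinalBSpline_succ p).of_le (by exact_mod_cast h)

lemma iteratedDeriv_succ_cardinalBSpline {n p : ℕ} (h : n ≤ p) (s : ℝ) :
    iteratedDeriv (n + 1) (cardinalBSpline (p + 2)) s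
      = iteratedDeriv n (cardinalBSpline (p + 1)) s
        - iteratedDeriv n (cardinalBSpline (p + 1)) (s - 1) := by
  have hc : ContDiff ℝ n (cardinalBSpline (p + 1)) := contDiff_cardinalBSpline_succ_of_le h
  have hc' : ContDiff ℝ n fun t => cardinalBSpline (p + 1) (t - 1) :=
    hc.comp (contDiff_id.sub contDiff_const)
  rw [iteratedDeriv_succ', deriv_cardinalBSpline_add_two,
    iteratedDeriv_fun_sub hc.contDiffAt hc'.contDiffAt, iteratedDeriv_comp_sub_const]

/-! ### Centred derivatives -/

/-- The derivative of order `2k` of the spline of degree `2p + 1`, centred at its midpoint. -/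
def centeredDeriv (p k : ℕ) (x : ℝ) : ℝ :=
  iteratedDeriv (2 * k) (cardinalBSpline (2 * p + 1)) ((p : ℝ) + 1 + x)

lemma centeredDeriv_succ_succ {p k : ℕ} (h : k ≤ p) (x : ℝ) :
    centeredDeriv (p + 1) (k + 1) x
      = centeredDeriv p k (x + 1) - 2 * centeredDeriv p k x + centeredDeriv p k (x - 1) := by
  unfold centeredDeriv
  rw [show 2 * (k + 1) = 2 * k + 1 + 1 by ring, show 2 * (p + 1) + 1 = 2 * p + 1 + 2 by ring,
    iteratedDeriv_succ_cardinalBSpline (by lia), iteratedDeriv_succ_cardinalBSpline (by lia),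
    iteratedDeriv_succ_cardinalBSpline (by lia)]
  push_cast
  rw [show (p : ℝ) + 1 + 1 + x - 1 = p + 1 + x by ring,
    show (p : ℝ) + 1 + 1 + x = p + 1 + (x + 1) by ring,
    show (p : ℝ) + 1 + x - 1 = p + 1 + (x - 1) by ring]
  ring

lemma centeredDeriv_zero (p : ℕ) (x : ℝ) :
    centeredDeriv p 0 x = cardinalBSpline (2 * p + 1) ((p : ℝ) + 1 + x) := by
  simp [centeredDeriv]

lemma centeredDeriv_neg {p k : ℕ} (h : k ≤ p) (x : ℝ) :
    centeredDeriv p k (-x) = centeredDeriv p k x := by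
  induction k generalizing p x with
  | zero =>
    rw [centeredDeriv_zero, centeredDeriv_zero, ← cardinalBSpline_succ_reflect]
    push_cast
    ring_nf
  | succ k ih =>
    obtain ⟨p, rfl⟩ : ∃ q, p = q + 1 := ⟨p - 1, by lia⟩
    have hk : k ≤ p := by lia
    rw [centeredDeriv_succ_succ hk, centeredDeriv_succ_succ hk, ih hk x,
      show -x + 1 = -(x - 1) by ring, show -x - 1 = -(x + 1) by ring, ih hk, ih hk]
    ring

lemma centeredDeriv_eq_zero {p k : ℕ} (h : k ≤ p) {x : ℝ} (hx : (p : ℝ) + 1 ≤ x) :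
    centeredDeriv p k x = 0 := by
  induction k generalizing p x with
  | zero =>
    rw [centeredDeriv_zero, cardinalBSpline_eq_zero_of_ge]
    push_cast
    linarith
  | succ k ih =>
    obtain ⟨p, rfl⟩ : ∃ q, p = q + 1 := ⟨p - 1, by lia⟩
    have hk : k ≤ p := by lia
    push_cast at hx
    rw [centeredDeriv_succ_succ hk, ih hk (by linarith), ih hk (by linarith), ih hk (by linarith)]
    ring

/-! ### Periodized inverse powers and termwise differentiation -/

/-- The periodization `∑_{j ∈ ℤ} (θ + 2jπ)^{-n}`. -/
def periodizedInvPow (n : ℕ) (θ : ℝ) : ℝ :=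
  ∑' j : ℤ, 1 / (θ + 2 * (j : ℝ) * Real.pi) ^ n

lemma periodizedInvPow_add_two_pi (n : ℕ) (θ : ℝ) :
    periodizedInvPow n (θ + 2 * Real.pi) = periodizedInvPow n θ := by
  unfold periodizedInvPow
  rw [← (Equiv.addRight (1 : ℤ)).tsum_eq (fun j : ℤ => 1 / (θ + 2 * (j : ℝ) * Real.pi) ^ n)]
  refine tsum_congr fun j => ?_
  simp only [Equiv.coe_addRight]
  push_cast
  ring_nf

/-- A bound uniform in `x`, giving the summable majorant for termwise differentiation; it works
because `2ε < 1`. -/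
lemma mul_abs_add_half_le {ε x : ℝ} (hx : x ∈ Set.Ioo ε (1 - ε)) (j : ℤ) :
    2 * ε * |(j : ℝ) + 1 / 2| ≤ |x + j| := by
  obtain ⟨h1, h2⟩ := hx
  rcases le_or_gt 0 j with hj | hj
  · have hj' : (0 : ℝ) ≤ j := by exact_mod_cast hj
    rw [abs_of_nonneg (by linarith : (0 : ℝ) ≤ (j : ℝ) + 1 / 2)]
    refine le_trans ?_ (le_abs_self _)
    nlinarith
  · have hj' : (j : ℝ) ≤ -1 := by exact_mod_cast Int.le_sub_one_of_lt hj
    rw [abs_of_nonpos (by linarith : (j : ℝ) + 1 / 2 ≤ 0)]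
    refine le_trans ?_ (neg_le_abs _)
    nlinarith

lemma add_intCast_ne_zero_of_mem_Ioo {x : ℝ} (hx : x ∈ Set.Ioo (0 : ℝ) 1) (j : ℤ) :
    x + j ≠ 0 := by
  intro h
  have h1 : ((-j : ℤ) : ℝ) = x := by push_cast; linarith
  have h2 : (0 : ℝ) < ((-j : ℤ) : ℝ) := h1 ▸ hx.1
  have h3 : ((-j : ℤ) : ℝ) < 1 := h1 ▸ hx.2
  norm_cast at h2 h3
  lia

lemma norm_one_div_add_intCast_pow_le {ε x : ℝ} (hε : 0 < ε) (hx : x ∈ Set.Ioo ε (1 - ε))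
    (n : ℕ) (j : ℤ) :
    ‖1 / (x + j) ^ n‖ ≤ (1 / (2 * ε) ^ n) * (1 / |(j : ℝ) + 1 / 2| ^ n) := by
  have hj : (j : ℝ) + 1 / 2 ≠ 0 := by
    have := add_intCast_ne_zero_of_mem_Ioo (x := 1 / 2) (by norm_num) j
    rwa [add_comm]
  have h0 : 0 < |(j : ℝ) + 1 / 2| := abs_pos.2 hj
  rw [one_div_mul_one_div, ← mul_pow, norm_div, norm_pow, norm_one, Real.norm_eq_abs]
  exact one_div_le_one_div_of_le (by positivity)
    (pow_le_pow_left₀ (by positivity) (mul_abs_add_half_le hx j) n)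

lemma summable_one_div_abs_add_half_pow {n : ℕ} (hn : 2 ≤ n) :
    Summable fun j : ℤ => 1 / |(j : ℝ) + 1 / 2| ^ n := by
  have := (Real.summable_one_div_int_add_rpow (1 / 2) n).2 (by exact_mod_cast hn)
  simpa only [Real.rpow_natCast] using this

lemma exists_mem_Ioo_sub {x : ℝ} (hx : x ∈ Set.Ioo (0 : ℝ) 1) :
    ∃ ε > 0, x ∈ Set.Ioo ε (1 - ε) := by
  obtain ⟨h0, h1⟩ := hx
  refine ⟨min x (1 - x) / 2, by have := lt_min h0 (sub_pos.2 h1); linarith, ?_, ?_⟩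
  · have := min_le_left x (1 - x); linarith
  · have := min_le_right x (1 - x); linarith

lemma summable_one_div_add_intCast_pow {n : ℕ} (hn : 2 ≤ n) {x : ℝ}
    (hx : x ∈ Set.Ioo (0 : ℝ) 1) : Summable fun j : ℤ => 1 / (x + j) ^ n := by
  obtain ⟨ε, hε, hxε⟩ := exists_mem_Ioo_sub hx
  exact Summable.of_norm_bounded ((summable_one_div_abs_add_half_pow hn).mul_left _)
    (norm_one_div_add_intCast_pow_le hε hxε n)

lemma hasDerivAt_one_div_add_pow {x c : ℝ} (h : x + c ≠ 0) (n : ℕ) :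
    HasDerivAt (fun y => 1 / (y + c) ^ n) (-n * (1 / (x + c) ^ (n + 1))) x := by
  have := (((hasDerivAt_id x).add_const c).fun_pow n).fun_inv (pow_ne_zero n h)
  simp only [one_div]
  refine this.congr_deriv ?_
  simp only [id]
  rcases n with _ | n
  · simp
  · simp only [Nat.add_sub_cancel]
    field_simp
    ring

lemma hasDerivAt_tsum_one_div_add_pow {n : ℕ} (hn : 2 ≤ n) {x : ℝ} (hx : x ∈ Set.Ioo (0 : ℝ) 1) :
    HasDerivAt (fun y => ∑' j : ℤ, 1 / (y + (j : ℝ)) ^ n) (-n * ∑' j : ℤ, 1 / (x + (j : ℝ)) ^ (n + 1)) x := by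
  obtain ⟨ε, hε, hxε⟩ := exists_mem_Ioo_sub hx
  rw [← tsum_mul_left]
  have hsub : ∀ y ∈ Set.Ioo ε (1 - ε), y ∈ Set.Ioo (0 : ℝ) 1 :=
    fun y hy => ⟨hε.trans hy.1, hy.2.trans (by linarith)⟩
  refine hasDerivAt_tsum_of_isPreconnected
    (((summable_one_div_abs_add_half_pow (n := n + 1) (by lia)).mul_left
      (1 / (2 * ε) ^ (n + 1))).mul_left (n : ℝ))
    isOpen_Ioo isPreconnected_Ioo
    (fun j y hy => hasDerivAt_one_div_add_pow (add_intCast_ne_zero_of_mem_Ioo (hsub y hy) j) n)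
    (fun j y hy => ?_) hxε (summable_one_div_add_intCast_pow hn hx) hxε
  rw [norm_mul, norm_neg, RCLike.norm_natCast]
  exact mul_le_mul_of_nonneg_left (norm_one_div_add_intCast_pow_le hε hy _ j) (Nat.cast_nonneg n)

/-! ### The cotangent series and the sum of inverse squares -/

/-- The Mittag-Leffler expansion of the cotangent on the unit interval. -/
lemma pi_mul_cot_pi_mul_eq {x : ℝ} (hx : x ∈ Set.Ioo (0 : ℝ) 1) :
    Real.pi * Real.cot (Real.pi * x)
      = 1 / x + ∑' n : ℕ, (1 / (x + ((-((n : ℤ) + 1) : ℤ) : ℝ)) + 1 / (x + (((n : ℤ) + 1 : ℤ) : ℝ))) := by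
  have hmem : (x : ℂ) ∈ Complex.integerComplement := by
    rintro ⟨j, hj⟩
    have hj' : (j : ℝ) = x := by exact_mod_cast hj
    exact add_intCast_ne_zero_of_mem_Ioo hx (-j) (by push_cast; linarith)
  have h := cot_series_rep' hmem
  rw [sub_eq_iff_eq_add] at h
  have h' : ((Real.pi * Real.cot (Real.pi * x) : ℝ) : ℂ) = ((1 / x + ∑' n : ℕ,
      (1 / (x + ((-((n : ℤ) + 1) : ℤ) : ℝ)) + 1 / (x + (((n : ℤ) + 1 : ℤ) : ℝ))) : ℝ) : ℂ) := by
    push_cast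
    rw [h, add_comm]
    congr 2
  exact_mod_cast h'

lemma summable_one_div_sub_add_one_div {x : ℝ} (hx : x ∈ Set.Ioo (0 : ℝ) 1) :
    Summable fun n : ℕ =>
      (1 / (x + ((-((n : ℤ) + 1) : ℤ) : ℝ)) + 1 / (x + (((n : ℤ) + 1 : ℤ) : ℝ))) := by
  have hmem : (x : ℂ) ∈ Complex.integerComplement := by
    rintro ⟨j, hj⟩
    have hj' : (j : ℝ) = x := by exact_mod_cast hj
    exact add_intCast_ne_zero_of_mem_Ioo hx (-j) (by push_cast; linarith)
  have h := summable_cotTerm hmem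
  rw [← Complex.summable_ofReal]
  refine h.congr fun n => ?_
  simp only [cotTerm]
  push_cast
  ring_nf

lemma neg_natCast_add_one_injective : Function.Injective fun n : ℕ => -((n : ℤ) + 1) :=
  fun a b h => by simpa using h

lemma natCast_add_one_injective : Function.Injective fun n : ℕ => (n : ℤ) + 1 :=
  fun a b h => by simpa using h

lemma hasDerivAt_one_div_add_one_div {y a b : ℝ} (ha : y + a ≠ 0) (hb : y + b ≠ 0) :
    HasDerivAt (fun y => 1 / (y + a) + 1 / (y + b))
      (-(1 / (y + a) ^ 2) + -(1 / (y + b) ^ 2)) y := by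
  have h1 := hasDerivAt_one_div_add_pow ha 1
  have h2 := hasDerivAt_one_div_add_pow hb 1
  simp only [pow_one] at h1 h2
  refine (h1.add h2).congr_deriv ?_
  norm_num

lemma hasDerivAt_tsum_cot {x : ℝ} (hx : x ∈ Set.Ioo (0 : ℝ) 1) :
    HasDerivAt (fun y => ∑' n : ℕ,
      (1 / (y + ((-((n : ℤ) + 1) : ℤ) : ℝ)) + 1 / (y + (((n : ℤ) + 1 : ℤ) : ℝ))))
      (∑' n : ℕ, (-(1 / (x + ((-((n : ℤ) + 1) : ℤ) : ℝ)) ^ 2)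
        + -(1 / (x + (((n : ℤ) + 1 : ℤ) : ℝ)) ^ 2))) x := by
  obtain ⟨ε, hε, hxε⟩ := exists_mem_Ioo_sub hx
  have hsub : ∀ y ∈ Set.Ioo ε (1 - ε), y ∈ Set.Ioo (0 : ℝ) 1 :=
    fun y hy => ⟨hε.trans hy.1, hy.2.trans (by linarith)⟩
  have hb := (summable_one_div_abs_add_half_pow (n := 2) le_rfl).mul_left (1 / (2 * ε) ^ 2)
  have hb1 := hb.comp_injective neg_natCast_add_one_injective
  have hb2 := hb.comp_injective natCast_add_one_injective
  refine hasDerivAt_tsum_of_isPreconnected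
    (g := fun (n : ℕ) (y : ℝ) =>
      1 / (y + ((-((n : ℤ) + 1) : ℤ) : ℝ)) + 1 / (y + (((n : ℤ) + 1 : ℤ) : ℝ)))
    (g' := fun (n : ℕ) (y : ℝ) => -(1 / (y + ((-((n : ℤ) + 1) : ℤ) : ℝ)) ^ 2)
      + -(1 / (y + (((n : ℤ) + 1 : ℤ) : ℝ)) ^ 2))
    (hb1.add hb2) isOpen_Ioo isPreconnected_Ioo
    (fun n y hy => hasDerivAt_one_div_add_one_div
      (add_intCast_ne_zero_of_mem_Ioo (hsub y hy) _)
      (add_intCast_ne_zero_of_mem_Ioo (hsub y hy) _))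
    (fun n y hy => ?_) hxε (summable_one_div_sub_add_one_div hx) hxε
  refine (norm_add_le _ _).trans (add_le_add ?_ ?_)
  · rw [norm_neg]; exact norm_one_div_add_intCast_pow_le hε hy 2 _
  · rw [norm_neg]; exact norm_one_div_add_intCast_pow_le hε hy 2 _

lemma hasDerivAt_pi_mul_cot_pi_mul {x : ℝ} (hsin : Real.sin (Real.pi * x) ≠ 0) :
    HasDerivAt (fun y => Real.pi * Real.cot (Real.pi * y))
      (-(Real.pi ^ 2 / Real.sin (Real.pi * x) ^ 2)) x := by
  have hlin : HasDerivAt (fun y => Real.pi * y) Real.pi x := by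
    simpa using (hasDerivAt_id x).const_mul Real.pi
  have h := ((hlin.cos.div hlin.sin hsin).const_mul Real.pi)
  simp only [Real.cot_eq_cos_div_sin]
  refine h.congr_deriv ?_
  have := Real.sin_sq_add_cos_sq (Real.pi * x)
  field_simp
  linear_combination -this

/-- Compare the closed-form and termwise derivatives of `π cot(πx)`. -/
lemma tsum_one_div_add_intCast_sq {x : ℝ} (hx : x ∈ Set.Ioo (0 : ℝ) 1) :
    ∑' j : ℤ, 1 / (x + j) ^ 2 = Real.pi ^ 2 / Real.sin (Real.pi * x) ^ 2 := by
  have hsin : Real.sin (Real.pi * x) ≠ 0 := by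
    refine (Real.sin_pos_of_pos_of_lt_pi ?_ ?_).ne'
    · exact mul_pos Real.pi_pos hx.1
    · nlinarith [Real.pi_pos, hx.2]
  have hx0 : x ≠ 0 := hx.1.ne'
  have hinv : HasDerivAt (fun y : ℝ => 1 / y) (-(1 / x ^ 2)) x := by
    simpa using hasDerivAt_inv hx0
  have hev : (fun y => Real.pi * Real.cot (Real.pi * y)) =ᶠ[𝓝 x] fun y => 1 / y + ∑' n : ℕ,
      (1 / (y + ((-((n : ℤ) + 1) : ℤ) : ℝ)) + 1 / (y + (((n : ℤ) + 1 : ℤ) : ℝ))) :=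
    eventuallyEq_of_mem (isOpen_Ioo.mem_nhds hx) fun y hy => pi_mul_cot_pi_mul_eq hy
  have heq := (hasDerivAt_pi_mul_cot_pi_mul hsin).unique
    ((hinv.fun_add (hasDerivAt_tsum_cot hx)).congr_of_eventuallyEq hev)
  have hs := summable_one_div_add_intCast_pow (n := 2) le_rfl hx
  have hs1 : Summable fun n : ℕ => 1 / (x + (((n : ℤ) + 1 : ℤ) : ℝ)) ^ 2 :=
    hs.comp_injective natCast_add_one_injective
  have hs2 : Summable fun n : ℕ => 1 / (x + ((-((n : ℤ) + 1) : ℤ) : ℝ)) ^ 2 :=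
    hs.comp_injective neg_natCast_add_one_injective
  rw [hs2.neg.tsum_add hs1.neg, tsum_neg, tsum_neg] at heq
  have hsplit := tsum_of_add_one_of_neg_add_one (f := fun j : ℤ => 1 / (x + (j : ℝ)) ^ 2) hs1 hs2
  rw [hsplit]
  simp only [Int.cast_zero, add_zero]
  linarith

/-! ### Transfer to the angle variable -/

lemma two_sub_two_cos_eq (θ : ℝ) : 2 - 2 * Real.cos θ = 4 * Real.sin (θ / 2) ^ 2 := by
  have h := Real.cos_sq (θ / 2)
  rw [mul_div_cancel₀ θ two_ne_zero] at h
  have := Real.sin_sq_add_cos_sq (θ / 2)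
  linear_combination 4 * h - 4 * this

lemma periodizedInvPow_eq_tsum (n : ℕ) (θ : ℝ) :
    periodizedInvPow n θ
      = (1 / (2 * Real.pi) ^ n) * ∑' j : ℤ, 1 / (θ / (2 * Real.pi) + j) ^ n := by
  rw [periodizedInvPow, ← tsum_mul_left]
  refine tsum_congr fun j => ?_
  have := Real.pi_ne_zero
  rw [one_div_mul_one_div, ← mul_pow]
  congr 2
  field_simp

lemma div_two_pi_mem_Ioo {θ : ℝ} (hθ : θ ∈ Set.Ioo 0 (2 * Real.pi)) :
    θ / (2 * Real.pi) ∈ Set.Ioo (0 : ℝ) 1 :=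
  ⟨div_pos hθ.1 Real.two_pi_pos, (div_lt_one Real.two_pi_pos).2 hθ.2⟩

lemma summable_periodizedInvPow {n : ℕ} (hn : 2 ≤ n) {θ : ℝ} (hθ : θ ∈ Set.Ioo 0 (2 * Real.pi)) :
    Summable fun j : ℤ => 1 / (θ + 2 * (j : ℝ) * Real.pi) ^ n := by
  refine ((summable_one_div_add_intCast_pow hn (div_two_pi_mem_Ioo hθ)).mul_left
    (1 / (2 * Real.pi) ^ n)).congr fun j => ?_
  have := Real.pi_ne_zero
  rw [one_div_mul_one_div, ← mul_pow]
  congr 2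
  field_simp

lemma hasDerivAt_periodizedInvPow {n : ℕ} (hn : 2 ≤ n) {θ : ℝ}
    (hθ : θ ∈ Set.Ioo 0 (2 * Real.pi)) :
    HasDerivAt (periodizedInvPow n) (-n * periodizedInvPow (n + 1) θ) θ := by
  rw [show periodizedInvPow n = _ from funext (periodizedInvPow_eq_tsum n),
    periodizedInvPow_eq_tsum (n + 1)]
  have h1 := (hasDerivAt_tsum_one_div_add_pow hn (div_two_pi_mem_Ioo hθ)).comp θ
    ((hasDerivAt_id θ).div_const (2 * Real.pi))
  refine (h1.const_mul (1 / (2 * Real.pi) ^ n)).congr_deriv ?_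
  have := Real.pi_ne_zero
  rw [pow_succ (2 * Real.pi) n]
  field_simp

lemma two_sub_two_cos_ne_zero {θ : ℝ} (hθ : θ ∈ Set.Ioo 0 (2 * Real.pi)) :
    2 - 2 * Real.cos θ ≠ 0 := by
  rw [two_sub_two_cos_eq]
  have : 0 < Real.sin (θ / 2) :=
    Real.sin_pos_of_pos_of_lt_pi (by linarith [hθ.1]) (by linarith [hθ.2])
  positivity

lemma periodizedInvPow_two {θ : ℝ} (hθ : θ ∈ Set.Ioo 0 (2 * Real.pi)) :
    periodizedInvPow 2 θ = 1 / (2 - 2 * Real.cos θ) := by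
  have := Real.pi_ne_zero
  have h : Real.sin (θ / 2) ≠ 0 :=
    (Real.sin_pos_of_pos_of_lt_pi (by linarith [hθ.1]) (by linarith [hθ.2])).ne'
  rw [periodizedInvPow_eq_tsum, tsum_one_div_add_intCast_sq (div_two_pi_mem_Ioo hθ),
    two_sub_two_cos_eq, show Real.pi * (θ / (2 * Real.pi)) = θ / 2 by field_simp]
  field_simp
  norm_num

/-! ### Generating polynomials of the integer samples -/

open Polynomial in
/-- The polynomials `∑_j Φ_n(j) X^j`, defined through the recursion satisfied by the values of the
B-spline at the integers. -/
def eulerFrobenius : ℕ → ℂ[X]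
  | 0 => 1
  | n + 1 => C (1 / ((n : ℂ) + 1))
      * (X * (1 - X) * derivative (eulerFrobenius n) + C ((n : ℂ) + 1) * (X * eulerFrobenius n))

lemma coeff_eulerFrobenius (n j : ℕ) :
    (eulerFrobenius n).coeff j = (cardinalBSpline n j : ℂ) := by
  induction n generalizing j with
  | zero =>
    simp only [eulerFrobenius, Polynomial.coeff_one, cardinalBSpline_zero_apply]
    rcases j with _ | j
    · simp
    · rw [if_neg (by lia), if_neg (by push_cast; intro h; linarith [h.2, (j.cast_nonneg : (0 : ℝ) ≤ j)])]
      simp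
  | succ n ih =>
    have hn : (n : ℂ) + 1 ≠ 0 := Nat.cast_add_one_ne_zero n
    rw [eulerFrobenius, Polynomial.coeff_C_mul, Polynomial.coeff_add, Polynomial.coeff_C_mul,
      mul_assoc, sub_mul, one_mul]
    rcases j with _ | j
    · simp [cardinalBSpline_succ_zero]
    · rw [Polynomial.coeff_X_mul, Polynomial.coeff_X_mul, Polynomial.coeff_sub,
        Polynomial.coeff_derivative, ih, ih, cardinalBSpline_succ]
      have hX : (Polynomial.X * Polynomial.derivative (eulerFrobenius n)).coeff j
          = (j : ℂ) * (cardinalBSpline n j : ℂ) := by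
        rcases j with _ | j
        · simp
        · rw [Polynomial.coeff_X_mul, Polynomial.coeff_derivative, ih]
          push_cast
          ring
      rw [hX]
      push_cast
      rw [add_sub_cancel_right]
      field_simp
      ring

lemma natDegree_eulerFrobenius_le (n : ℕ) : (eulerFrobenius n).natDegree ≤ n := by
  rw [Polynomial.natDegree_le_iff_coeff_eq_zero]
  intro N hN
  rw [coeff_eulerFrobenius, cardinalBSpline_eq_zero_of_ge n (by exact_mod_cast hN)]
  simp

lemma eval_eulerFrobenius (n : ℕ) (z : ℂ) :
    (eulerFrobenius n).eval z
      = ∑ j ∈ Finset.range (n + 1), (cardinalBSpline n j : ℂ) * z ^ j := by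
  rw [Polynomial.eval_eq_sum_range' (Nat.lt_succ_of_le (natDegree_eulerFrobenius_le n))]
  simp only [coeff_eulerFrobenius]

lemma eval_eulerFrobenius_succ (n : ℕ) (z : ℂ) :
    ((n : ℂ) + 1) * (eulerFrobenius (n + 1)).eval z
      = z * (1 - z) * (Polynomial.derivative (eulerFrobenius n)).eval z
        + ((n : ℂ) + 1) * (z * (eulerFrobenius n).eval z) := by
  have hn : (n : ℂ) + 1 ≠ 0 := Nat.cast_add_one_ne_zero n
  simp only [eulerFrobenius, Polynomial.eval_mul, Polynomial.eval_add, Polynomial.eval_C,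
    Polynomial.eval_X, Polynomial.eval_sub, Polynomial.eval_one]
  field_simp

lemma eval_one_eulerFrobenius (n : ℕ) : (eulerFrobenius n).eval 1 = 1 := by
  induction n with
  | zero => simp [eulerFrobenius]
  | succ n ih =>
    have hn : (n : ℂ) + 1 ≠ 0 := Nat.cast_add_one_ne_zero n
    have h := eval_eulerFrobenius_succ n 1
    rw [ih] at h
    simpa [hn] using h

/-- The polynomial recursion is exactly what the quotient rule produces here. -/
lemma hasDerivAt_eulerFrobenius_div (n : ℕ) {z : ℂ} (hz : 1 - z ≠ 0) (h0 : z ≠ 0) :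
    HasDerivAt (fun w => (eulerFrobenius n).eval w / (1 - w) ^ (n + 1))
      (((n : ℂ) + 1) * (eulerFrobenius (n + 1)).eval z / (z * (1 - z) ^ (n + 2))) z := by
  have h1 := (eulerFrobenius n).hasDerivAt z
  have h2 := (((hasDerivAt_id z).const_sub 1).fun_pow (n + 1))
  refine (h1.fun_div h2 (pow_ne_zero _ hz)).congr_deriv ?_
  rw [eval_eulerFrobenius_succ]
  simp only [id, Nat.add_sub_cancel]
  field_simp
  push_cast
  ring

lemma one_sub_exp_mul_I_sq (θ : ℝ) :
    (1 - Complex.exp (θ * Complex.I)) ^ 2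
      = -(Complex.exp (θ * Complex.I) * ((2 - 2 * Real.cos θ : ℝ) : ℂ)) := by
  have h : Complex.exp (θ * Complex.I) * Complex.exp (-θ * Complex.I) = 1 := by
    rw [← Complex.exp_add]; simp
  push_cast
  rw [Complex.cos]
  linear_combination -h

lemma one_sub_exp_mul_I_ne_zero {θ : ℝ} (hθ : θ ∈ Set.Ioo 0 (2 * Real.pi)) :
    1 - Complex.exp (θ * Complex.I) ≠ 0 := by
  intro h
  have h2 := one_sub_exp_mul_I_sq θ
  rw [h, zero_pow two_ne_zero, eq_comm, neg_eq_zero, mul_eq_zero, Complex.ofReal_eq_zero] at h2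
  exact h2.elim (Complex.exp_ne_zero _) (two_sub_two_cos_ne_zero hθ)

lemma eval_eulerFrobenius_one (z : ℂ) : (eulerFrobenius 1).eval z = z := by
  simp [eulerFrobenius]

/-- The generating polynomial on the unit circle is a periodized power. -/
lemma eval_eulerFrobenius_div_eq {n : ℕ} (hn : 1 ≤ n) {θ : ℝ}
    (hθ : θ ∈ Set.Ioo 0 (2 * Real.pi)) :
    (eulerFrobenius n).eval (Complex.exp (θ * Complex.I))
        / (1 - Complex.exp (θ * Complex.I)) ^ (n + 1)
      = Complex.I ^ (n + 1) * (periodizedInvPow (n + 1) θ : ℂ) := by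
  induction n, hn using Nat.le_induction generalizing θ with
  | base =>
    have h0 : ((2 - 2 * Real.cos θ : ℝ) : ℂ) ≠ 0 :=
      Complex.ofReal_ne_zero.2 (two_sub_two_cos_ne_zero hθ)
    have h1 := Complex.exp_ne_zero (θ * Complex.I)
    rw [eval_eulerFrobenius_one, one_sub_exp_mul_I_sq, periodizedInvPow_two hθ, Complex.I_sq,
      Complex.ofReal_div, Complex.ofReal_one]
    field_simp
  | succ n hn ih =>
    have hz := one_sub_exp_mul_I_ne_zero hθ
    have hexp : HasDerivAt (fun t : ℝ => Complex.exp (t * Complex.I))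
        (Complex.exp (θ * Complex.I) * Complex.I) θ := by
      simpa using ((Complex.ofRealCLM.hasDerivAt (x := θ)).mul_const Complex.I).cexp
    -- Differentiate both sides of the induction hypothesis in `θ`, which holds near `θ`, and use
    -- uniqueness of the derivative.
    have hl := HasDerivAt.comp θ (hasDerivAt_eulerFrobenius_div n hz (Complex.exp_ne_zero _)) hexp
    have hr := ((hasDerivAt_periodizedInvPow (n := n + 1) (by lia) hθ).ofReal_comp).const_mul
      (Complex.I ^ (n + 1))
    have heq := hl.unique (hr.congr_of_eventuallyEq
      (eventuallyEq_of_mem (isOpen_Ioo.mem_nhds hθ) fun t ht => ih ht))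
    have hn0 : (n : ℂ) + 1 ≠ 0 := Nat.cast_add_one_ne_zero n
    have h1 := Complex.exp_ne_zero (θ * Complex.I)
    have hI := Complex.I_ne_zero
    push_cast at heq
    refine mul_left_cancel₀ (mul_ne_zero hn0 hI) ?_
    have hleft : ((n : ℂ) + 1) * Complex.I
        * ((eulerFrobenius (n + 1)).eval (Complex.exp (θ * Complex.I))
          / (1 - Complex.exp (θ * Complex.I)) ^ (n + 1 + 1))
        = ((n : ℂ) + 1) * (eulerFrobenius (n + 1)).eval (Complex.exp (θ * Complex.I))
          / (Complex.exp (θ * Complex.I) * (1 - Complex.exp (θ * Complex.I)) ^ (n + 2))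
          * (Complex.exp (θ * Complex.I) * Complex.I) := by
      field_simp
    rw [hleft, heq, pow_succ Complex.I (n + 1)]
    linear_combination (-((n : ℂ) + 1) * Complex.I ^ (n + 1)
      * (periodizedInvPow (n + 1 + 1) θ : ℂ)) * Complex.I_sq

/-- For odd degree, `(1-z)^{2m+2}` is a power of `(1-z)² = -z(2 - 2 cos θ)`; its sign cancels that
of `I^{2m+2}`. -/
lemma eval_eulerFrobenius_odd (m : ℕ) {θ : ℝ} (hθ : θ ∈ Set.Ioo 0 (2 * Real.pi)) :
    (eulerFrobenius (2 * m + 1)).eval (Complex.exp (θ * Complex.I))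
      = Complex.exp (θ * Complex.I) ^ (m + 1) * (massSymbolExpr m θ : ℂ) := by
  have h := eval_eulerFrobenius_div_eq (n := 2 * m + 1) (by lia) hθ
  rw [div_eq_iff (pow_ne_zero _ (one_sub_exp_mul_I_ne_zero hθ)),
    show 2 * m + 1 + 1 = 2 * (m + 1) by ring, pow_mul (1 - _), one_sub_exp_mul_I_sq, pow_mul,
    Complex.I_sq, neg_pow (_ * _), mul_pow] at h
  rw [h, massSymbolExpr]
  change _ = _ * (((2 - 2 * Real.cos θ) ^ (m + 1) * periodizedInvPow (2 * (m + 1)) θ : ℝ) : ℂ)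
  push_cast
  have hs : ((-1 : ℂ) ^ (m + 1)) * (-1) ^ (m + 1) = 1 := by
    rw [← mul_pow]; simp
  linear_combination (periodizedInvPow (2 * (m + 1)) θ * Complex.exp (θ * Complex.I) ^ (m + 1)
    * (2 - 2 * Complex.cos θ) ^ (m + 1) : ℂ) * hs

/-! ### The symbol and its reduction to `k = 0` -/

/-- The symbol `∑_{j ∈ ℤ} Φ^{(2k)}(p + 1 + j) e^{ijθ}` of the centred spline of degree `2p + 1`. -/
def splineSymbol (p k : ℕ) (θ : ℝ) : ℂ :=
  ∑' j : ℤ, (centeredDeriv p k j : ℂ) * Complex.exp (j * (θ * Complex.I))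

lemma centeredDeriv_intCast_eq_zero {p k : ℕ} (h : k ≤ p) {j : ℤ}
    (hj : j ∉ Finset.Icc (-(p : ℤ)) p) : centeredDeriv p k j = 0 := by
  rw [Finset.mem_Icc, not_and_or, not_le, not_le] at hj
  rcases hj with hj | hj
  · rw [← neg_neg (j : ℝ), centeredDeriv_neg h, centeredDeriv_eq_zero h]
    have : (p : ℤ) + 1 ≤ -j := by lia
    exact_mod_cast this
  · rw [centeredDeriv_eq_zero h]
    exact_mod_cast hj

lemma splineSymbol_term_eq_zero {p k : ℕ} (h : k ≤ p) (θ : ℝ) {j : ℤ}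
    (hj : j ∉ Finset.Icc (-(p : ℤ)) p) :
    (centeredDeriv p k j : ℂ) * Complex.exp (j * (θ * Complex.I)) = 0 := by
  rw [centeredDeriv_intCast_eq_zero h hj]
  simp

lemma splineSymbol_eq_sum {p k : ℕ} (h : k ≤ p) (θ : ℝ) :
    splineSymbol p k θ = ∑ j ∈ Finset.Icc (-(p : ℤ)) p,
      (centeredDeriv p k j : ℂ) * Complex.exp (j * (θ * Complex.I)) :=
  tsum_eq_sum fun _ hj => splineSymbol_term_eq_zero h θ hj

lemma summable_splineSymbol {p k : ℕ} (h : k ≤ p) (θ : ℝ) :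
    Summable fun j : ℤ => (centeredDeriv p k j : ℂ) * Complex.exp (j * (θ * Complex.I)) :=
  summable_of_ne_finset_zero fun _ hj => splineSymbol_term_eq_zero h θ hj

lemma continuous_splineSymbol {p k : ℕ} (h : k ≤ p) : Continuous (splineSymbol p k) := by
  rw [show splineSymbol p k = _ from funext (splineSymbol_eq_sum h)]
  fun_prop

lemma splineSymbol_add_two_pi (p k : ℕ) (θ : ℝ) :
    splineSymbol p k (θ + 2 * Real.pi) = splineSymbol p k θ := by
  refine tsum_congr fun j => ?_
  congr 1
  rw [← Complex.exp_periodic.int_mul j (j * (θ * Complex.I))]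
  congr 1
  push_cast
  ring

lemma tsum_mul_add_one_sub_add_mul_sub_one {f : ℤ → ℂ} (hf : Summable f) (a b : ℂ) :
    ∑' j : ℤ, (a * f (j + 1) - 2 * f j + b * f (j - 1)) = (a - 2 + b) * ∑' j, f j := by
  have h1 : HasSum (fun j => f (j + 1)) (∑' j, f j) :=
    (Equiv.addRight (1 : ℤ)).hasSum_iff.2 hf.hasSum
  have h2 : HasSum (fun j => f (j - 1)) (∑' j, f j) :=
    (Equiv.subRight (1 : ℤ)).hasSum_iff.2 hf.hasSum
  rw [(((h1.mul_left a).sub (hf.hasSum.mul_left 2)).add (h2.mul_left b)).tsum_eq]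
  ring

/-- Shifts of the samples become phases: the second difference has symbol `e^{-iθ} - 2 + e^{iθ}`. -/
lemma splineSymbol_succ_succ {p k : ℕ} (h : k ≤ p) (θ : ℝ) :
    splineSymbol (p + 1) (k + 1) θ
      = -((2 - 2 * Real.cos θ : ℝ) : ℂ) * splineSymbol p k θ := by
  have hterm : ∀ j : ℤ,
      (centeredDeriv (p + 1) (k + 1) j : ℂ) * Complex.exp (j * (θ * Complex.I))
        = Complex.exp (-θ * Complex.I) * ((centeredDeriv p k ((j + 1 : ℤ) : ℝ) : ℂ)
            * Complex.exp (((j + 1 : ℤ) : ℂ) * (θ * Complex.I)))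
          - 2 * ((centeredDeriv p k j : ℂ) * Complex.exp (j * (θ * Complex.I)))
          + Complex.exp (θ * Complex.I) * ((centeredDeriv p k ((j - 1 : ℤ) : ℝ) : ℂ)
            * Complex.exp (((j - 1 : ℤ) : ℂ) * (θ * Complex.I))) := by
    intro j
    have e1 : Complex.exp (j * (θ * Complex.I))
        = Complex.exp (-θ * Complex.I) * Complex.exp ((j + 1) * (θ * Complex.I)) := by
      rw [← Complex.exp_add]; ring_nf
    have e2 : Complex.exp (j * (θ * Complex.I))
        = Complex.exp (θ * Complex.I) * Complex.exp ((j - 1) * (θ * Complex.I)) := by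
      rw [← Complex.exp_add]; ring_nf
    rw [centeredDeriv_succ_succ h]
    push_cast
    linear_combination (centeredDeriv p k (j + 1) : ℂ) * e1 + (centeredDeriv p k (j - 1) : ℂ) * e2
  rw [splineSymbol, tsum_congr hterm,
    tsum_mul_add_one_sub_add_mul_sub_one (summable_splineSymbol h θ), splineSymbol]
  push_cast
  rw [Complex.cos]
  ring

lemma splineSymbol_eq_mul {p k : ℕ} (h : k ≤ p) (θ : ℝ) :
    splineSymbol p k θ
      = (((-1) ^ k * (2 - 2 * Real.cos θ) ^ k : ℝ) : ℂ) * splineSymbol (p - k) 0 θ := by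
  induction k generalizing p with
  | zero => simp
  | succ k ih =>
    obtain ⟨p, rfl⟩ : ∃ q, p = q + 1 := ⟨p - 1, by lia⟩
    rw [splineSymbol_succ_succ (by lia), ih (by lia), Nat.add_sub_add_right]
    push_cast
    ring

lemma exp_pow_mul_splineSymbol_zero (m : ℕ) (θ : ℝ) :
    Complex.exp (θ * Complex.I) ^ (m + 1) * splineSymbol m 0 θ
      = (eulerFrobenius (2 * m + 1)).eval (Complex.exp (θ * Complex.I)) := by
  rw [eval_eulerFrobenius, splineSymbol, ← tsum_mul_left,
    -- Undo the centring at `m + 1`, so that only the indices `0, …, 2m + 1` can contribute.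
    ← (Equiv.addRight (-((m : ℤ) + 1))).tsum_eq]
  rw [tsum_eq_sum (s := (Finset.range (2 * m + 1 + 1)).map Nat.castEmbedding), Finset.sum_map]
  · refine Finset.sum_congr rfl fun j _ => ?_
    simp only [Nat.castEmbedding_apply, Equiv.coe_addRight, centeredDeriv_zero]
    rw [← Complex.exp_nat_mul, ← Complex.exp_nat_mul, mul_left_comm, ← Complex.exp_add]
    push_cast
    ring_nf
  · intro j hj
    simp only [Equiv.coe_addRight, centeredDeriv_zero]
    have hj' : j < 0 ∨ (2 * m + 1 : ℤ) + 1 ≤ j := by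
      by_contra! hcon
      refine hj (Finset.mem_map.2 ⟨j.toNat, ?_, ?_⟩)
      · rw [Finset.mem_range]; lia
      · simp [hcon.1]
    have hcast : (m : ℝ) + 1 + ((j + -((m : ℤ) + 1) : ℤ) : ℝ) = j := by push_cast; ring
    rw [hcast]
    rcases hj' with hj' | hj'
    · rw [cardinalBSpline_eq_zero_of_neg _ (by exact_mod_cast hj')]; simp
    · rw [cardinalBSpline_eq_zero_of_ge _ (by exact_mod_cast hj')]; simp

/-! ### Identification with `M_m` and `D_p^k` -/

lemma massSymbolExpr_add_two_pi (m : ℕ) (θ : ℝ) :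
    massSymbolExpr m (θ + 2 * Real.pi) = massSymbolExpr m θ := by
  have h := periodizedInvPow_add_two_pi (2 * m + 2) θ
  unfold periodizedInvPow at h
  rw [massSymbolExpr, massSymbolExpr, h, Real.cos_add_two_pi]

/-- The analysis lives on the pole-free interval `(0, 2π)`; periodicity carries it to negative
angles. -/
lemma mem_Ioo_or_add_two_pi_mem_Ioo {θ : ℝ} (hθ : θ ∈ Set.Icc (-Real.pi) Real.pi) (h0 : θ ≠ 0) :
    θ ∈ Set.Ioo 0 (2 * Real.pi) ∨ θ + 2 * Real.pi ∈ Set.Ioo 0 (2 * Real.pi) := by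
  have := Real.pi_pos
  rcases h0.lt_or_gt with h | h
  · exact Or.inr ⟨by linarith [hθ.1], by linarith⟩
  · exact Or.inl ⟨h, by linarith [hθ.2]⟩

lemma splineSymbol_zero_eq_of_mem_Ioo (m : ℕ) {θ : ℝ} (hθ : θ ∈ Set.Ioo 0 (2 * Real.pi)) :
    splineSymbol m 0 θ = (massSymbolExpr m θ : ℂ) := by
  have h := exp_pow_mul_splineSymbol_zero m θ
  rw [eval_eulerFrobenius_odd m hθ] at h
  exact mul_left_cancel₀ (pow_ne_zero _ (Complex.exp_ne_zero _)) h

lemma splineSymbol_zero_eq_massSymbolExpr (m : ℕ) {θ : ℝ}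
    (hθ : θ ∈ Set.Icc (-Real.pi) Real.pi) (h0 : θ ≠ 0) :
    splineSymbol m 0 θ = (massSymbolExpr m θ : ℂ) := by
  rcases mem_Ioo_or_add_two_pi_mem_Ioo hθ h0 with h | h
  · exact splineSymbol_zero_eq_of_mem_Ioo m h
  · rw [← splineSymbol_add_two_pi, ← massSymbolExpr_add_two_pi]
    exact splineSymbol_zero_eq_of_mem_Ioo m h

lemma splineSymbol_zero_zero (m : ℕ) : splineSymbol m 0 0 = 1 := by
  have h := exp_pow_mul_splineSymbol_zero m 0
  simpa [eval_one_eulerFrobenius] using h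

lemma tendsto_massSymbolExpr (m : ℕ) : Tendsto (massSymbolExpr m) (𝓝[≠] 0) (𝓝 1) := by
  have hc : Continuous fun θ => (splineSymbol m 0 θ).re :=
    Complex.continuous_re.comp (continuous_splineSymbol (Nat.zero_le m))
  have h := (hc.tendsto 0).mono_left (nhdsWithin_le_nhds (s := {0}ᶜ))
  rw [splineSymbol_zero_zero, Complex.one_re] at h
  refine h.congr' ?_
  filter_upwards [self_mem_nhdsWithin, mem_nhdsWithin_of_mem_nhds
    (Icc_mem_nhds (neg_lt_zero.2 Real.pi_pos) Real.pi_pos)] with θ h0 hθ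
  rw [splineSymbol_zero_eq_massSymbolExpr m hθ h0, Complex.ofReal_re]

lemma massSymbol_zero_right (m : ℕ) : massSymbol m 0 = 1 := by
  rw [massSymbol, if_pos rfl]
  exact (tendsto_massSymbolExpr m).limUnder_eq

lemma massSymbol_of_ne_zero (m : ℕ) {θ : ℝ} (h : θ ≠ 0) : massSymbol m θ = massSymbolExpr m θ :=
  if_neg h

lemma splineSymbol_zero_eq_massSymbol (m : ℕ) {θ : ℝ} (hθ : θ ∈ Set.Icc (-Real.pi) Real.pi) :
    splineSymbol m 0 θ = (massSymbol m θ : ℂ) := by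
  rcases eq_or_ne θ 0 with rfl | h0
  · rw [splineSymbol_zero_zero, massSymbol_zero_right, Complex.ofReal_one]
  · rw [massSymbol_of_ne_zero m h0, splineSymbol_zero_eq_massSymbolExpr m hθ h0]

lemma splineSymbol_eq_penaltySymbol {p k : ℕ} (h : k ≤ p) {θ : ℝ}
    (hθ : θ ∈ Set.Icc (-Real.pi) Real.pi) :
    splineSymbol p k θ = (penaltySymbol p k θ : ℂ) := by
  rw [splineSymbol_eq_mul h, splineSymbol_zero_eq_massSymbol _ hθ, penaltySymbol]
  push_cast
  ring

lemma splineSymbol_eq_cosine_sum {p k : ℕ} (h : k ≤ p) (θ : ℝ) :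
    splineSymbol p k θ = (centeredDeriv p k 0 : ℂ) + ∑ j ∈ Finset.Icc 1 p,
      (centeredDeriv p k (-(j : ℝ)) : ℂ) * (Complex.exp (-(Complex.I * (j : ℂ) * (θ : ℂ)))
        + Complex.exp (Complex.I * (j : ℂ) * (θ : ℂ))) := by
  -- Pairing `j` with `-j` counts the index `0` twice; the surplus term is subtracted at the end.
  have hsum := tsum_nat_add_neg (summable_splineSymbol h θ)
  rw [tsum_eq_sum (s := insert 0 (Finset.Icc 1 p)), Finset.sum_insert (by simp)] at hsum
  · have hterm : ∀ j ∈ Finset.Icc 1 p,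
        (centeredDeriv p k ((j : ℤ) : ℝ) : ℂ) * Complex.exp (((j : ℤ) : ℂ) * (θ * Complex.I))
          + (centeredDeriv p k ((-(j : ℤ) : ℤ) : ℝ) : ℂ)
            * Complex.exp (((-(j : ℤ) : ℤ) : ℂ) * (θ * Complex.I))
        = (centeredDeriv p k (-(j : ℝ)) : ℂ) * (Complex.exp (-(Complex.I * (j : ℂ) * (θ : ℂ)))
          + Complex.exp (Complex.I * (j : ℂ) * (θ : ℂ))) := by
      intro j _
      push_cast
      rw [centeredDeriv_neg h]
      ring_nf
    rw [Finset.sum_congr rfl hterm] at hsum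
    simp only [Nat.cast_zero, Int.cast_zero, neg_zero, zero_mul, Complex.exp_zero, mul_one] at hsum
    rw [splineSymbol]
    linear_combination -hsum
  · intro j hj
    have hj' : p < j := by
      by_contra hcon
      simp only [Finset.mem_insert, Finset.mem_Icc] at hj
      lia
    rw [splineSymbol_term_eq_zero h θ (by rw [Finset.mem_Icc]; lia),
      splineSymbol_term_eq_zero h θ (by rw [Finset.mem_Icc]; lia), add_zero]

lemma massSymbol_zero_left {θ : ℝ} (hθ : θ ∈ Set.Icc (-Real.pi) Real.pi) :
    massSymbol 0 θ = 1 := by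
  rcases eq_or_ne θ 0 with rfl | h0
  · exact massSymbol_zero_right 0
  have key : ∀ {t : ℝ}, t ∈ Set.Ioo 0 (2 * Real.pi) → massSymbolExpr 0 t = 1 := by
    intro t ht
    have := periodizedInvPow_two ht
    unfold periodizedInvPow at this
    rw [massSymbolExpr, mul_zero, zero_add, zero_add, pow_one, this]
    exact mul_one_div_cancel (two_sub_two_cos_ne_zero ht)
  rw [massSymbol_of_ne_zero 0 h0]
  rcases mem_Ioo_or_add_two_pi_mem_Ioo hθ h0 with h | h
  · exact key h
  · rw [← massSymbolExpr_add_two_pi, key h]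

lemma summable_periodizedInvPow_of_mem_Icc {n : ℕ} (hn : 2 ≤ n) {θ : ℝ}
    (hθ : θ ∈ Set.Icc (-Real.pi) Real.pi) (h0 : θ ≠ 0) :
    Summable fun j : ℤ => 1 / (θ + 2 * (j : ℝ) * Real.pi) ^ n := by
  rcases mem_Ioo_or_add_two_pi_mem_Ioo hθ h0 with h | h
  · exact summable_periodizedInvPow hn h
  · rw [← (Equiv.addRight (1 : ℤ)).summable_iff]
    refine (summable_periodizedInvPow hn h).congr fun j => ?_
    simp only [Function.comp_apply, Equiv.coe_addRight]
    push_cast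
    ring_nf

lemma two_mul_add_one_tsub {p k : ℕ} (h : k ≤ p) : 2 * (p + 1 - k) = 2 * (p - k) + 2 := by lia

lemma explicit_eq_mul_massSymbolExpr {p k : ℕ} (h : k ≤ p) (θ : ℝ) :
    (-1) ^ k * (2 - 2 * Real.cos θ) ^ (p + 1)
        * ∑' j : ℤ, 1 / (θ + 2 * (j : ℝ) * Real.pi) ^ (2 * (p + 1 - k))
      = (-1) ^ k * (2 - 2 * Real.cos θ) ^ k * massSymbolExpr (p - k) θ := by
  rw [massSymbolExpr, two_mul_add_one_tsub h, show p + 1 = k + (p - k + 1) by lia, pow_add]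
  ring

/-! ### Values at `π` and the zeta function -/

lemma tsum_one_div_odd_pow {n : ℕ} (hn : 2 ≤ n) :
    ((∑' j : ℕ, 1 / (2 * (j : ℝ) + 1) ^ n : ℝ) : ℂ) = (1 - 1 / 2 ^ n) * riemannZeta n := by
  have hs : Summable fun j : ℕ => 1 / (j : ℝ) ^ n := Real.summable_one_div_nat_pow.2 (by lia)
  have he : Summable fun j : ℕ => 1 / ((2 * j : ℕ) : ℝ) ^ n :=
    hs.comp_injective (i := fun j : ℕ => 2 * j) fun a b h => by simpa using h
  have ho : Summable fun j : ℕ => 1 / ((2 * j + 1 : ℕ) : ℝ) ^ n :=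
    hs.comp_injective (i := fun j : ℕ => 2 * j + 1) fun a b h => by simpa using h
  have h := tsum_even_add_odd (f := fun j : ℕ => 1 / (j : ℝ) ^ n) he ho
  have hz : riemannZeta n = ((∑' j : ℕ, 1 / (j : ℝ) ^ n : ℝ) : ℂ) := by
    rw [zeta_nat_eq_tsum_of_gt_one (by lia)]
    push_cast
    rfl
  have heven : ∑' j : ℕ, 1 / ((2 * j : ℕ) : ℝ) ^ n = 1 / 2 ^ n * ∑' j : ℕ, 1 / (j : ℝ) ^ n := by
    rw [← tsum_mul_left]
    refine tsum_congr fun j => ?_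
    push_cast
    rw [mul_pow, one_div_mul_one_div]
  rw [heven] at h
  rw [hz]
  push_cast at h
  rw [← eq_sub_iff_add_eq'] at h
  rw [h]
  push_cast
  ring

/-- At `π` the terms for `j` and `-(j + 1)` have opposite bases, hence agree for even `n`; this
gives the factor `2`. -/
lemma periodizedInvPow_pi {n : ℕ} (hn : 2 ≤ n) (he : Even n) :
    periodizedInvPow n Real.pi = 2 / Real.pi ^ n * ∑' j : ℕ, 1 / (2 * (j : ℝ) + 1) ^ n := by
  have hs := summable_periodizedInvPow hn (θ := Real.pi)
    ⟨Real.pi_pos, by linarith [Real.pi_pos]⟩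
  have h := tsum_nat_add_neg_add_one hs
  rw [periodizedInvPow, ← h, ← tsum_mul_left]
  refine tsum_congr fun j => ?_
  have e1 : Real.pi + 2 * (((j : ℕ) : ℤ) : ℝ) * Real.pi = Real.pi * (2 * (j : ℝ) + 1) := by
    push_cast; ring
  have e2 : Real.pi + 2 * ((-((j : ℤ) + 1) : ℤ) : ℝ) * Real.pi
      = -(Real.pi * (2 * (j : ℝ) + 1)) := by
    push_cast; ring
  rw [e1, e2, he.neg_pow, mul_pow]
  have := Real.pi_ne_zero
  have : (2 * (j : ℝ) + 1) ≠ 0 := by positivity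
  field_simp
  norm_num

lemma massSymbol_pi (m : ℕ) :
    (massSymbol m Real.pi : ℂ) = 2 * ((2 ^ (2 * m + 2) - 1) / (Real.pi : ℂ) ^ (2 * m + 2))
      * riemannZeta ((2 * m + 2 : ℕ) : ℂ) := by
  rw [massSymbol_of_ne_zero m Real.pi_ne_zero, massSymbolExpr]
  change (((2 - 2 * Real.cos Real.pi) ^ (m + 1) * periodizedInvPow (2 * m + 2) Real.pi : ℝ) : ℂ) = _
  rw [periodizedInvPow_pi (by lia) ⟨m + 1, by ring⟩, Complex.ofReal_mul, Complex.ofReal_mul,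
    tsum_one_div_odd_pow (by lia), Real.cos_pi]
  have hpi : (Real.pi : ℂ) ≠ 0 := Complex.ofReal_ne_zero.2 Real.pi_ne_zero
  have h4 : (2 - 2 * (-1 : ℂ)) ^ (m + 1) = 2 ^ (2 * m + 2) := by
    rw [show 2 * m + 2 = 2 * (m + 1) by ring, pow_mul]; norm_num
  push_cast
  rw [h4]
  field_simp

lemma penaltySymbol_pi (p k : ℕ) :
    penaltySymbol p k Real.pi = (-1) ^ k * 2 ^ (2 * k) * massSymbol (p - k) Real.pi := by
  rw [penaltySymbol, Real.cos_pi, pow_mul]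
  norm_num

end

theorem proposition6p2 (p k : ℕ) (hk : k ≤ p) :
    -- the derivatives of order `2k` of `Φ_{2p+1}` are classical
    ContDiff ℝ ((2 * k : ℕ) : ℕ∞) (cardinalBSpline (2 * p + 1)) ∧
    -- the relation for the symbol on `[-π, π]`
    (∀ θ ∈ Set.Icc (-Real.pi) Real.pi,
      ((iteratedDeriv (2 * k) (cardinalBSpline (2 * p + 1)) ((p : ℝ) + 1) : ℝ) : ℂ)
        + ∑ j ∈ Finset.Icc 1 p,
            ((iteratedDeriv (2 * k) (cardinalBSpline (2 * p + 1)) ((p : ℝ) + 1 - (j : ℝ)) : ℝ) : ℂ)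
              * (Complex.exp (-(Complex.I * (j : ℂ) * (θ : ℂ)))
                + Complex.exp (Complex.I * (j : ℂ) * (θ : ℂ)))
        = ((penaltySymbol p k θ : ℝ) : ℂ)) ∧
    -- `M_0` is identically `1`
    (∀ θ ∈ Set.Icc (-Real.pi) Real.pi, massSymbol 0 θ = 1) ∧
    -- the explicit form of `D_p^k`, with convergence of the series
    (∀ θ ∈ Set.Icc (-Real.pi) Real.pi, θ ≠ 0 →
      Summable (fun j : ℤ => 1 / (θ + 2 * (j : ℝ) * Real.pi) ^ (2 * (p + 1 - k))) ∧
      penaltySymbol p k θ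
        = (-1) ^ k * (2 - 2 * Real.cos θ) ^ (p + 1)
          * ∑' j : ℤ, 1 / (θ + 2 * (j : ℝ) * Real.pi) ^ (2 * (p + 1 - k))) ∧
    -- at `θ = 0` the explicit form is to be read as a limit
    Filter.Tendsto
      (fun θ : ℝ => (-1) ^ k * (2 - 2 * Real.cos θ) ^ (p + 1)
          * ∑' j : ℤ, 1 / (θ + 2 * (j : ℝ) * Real.pi) ^ (2 * (p + 1 - k)))
      (nhdsWithin (0 : ℝ) {0}ᶜ) (nhds (penaltySymbol p k 0)) ∧
    -- the values at `0`
    penaltySymbol p 0 0 = 1 ∧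
    (1 ≤ k → penaltySymbol p k 0 = 0) ∧
    -- the value at `π`
    penaltySymbol p k Real.pi = (-1) ^ k * 2 ^ (2 * k) * massSymbol (p - k) Real.pi ∧
    ((penaltySymbol p k Real.pi : ℝ) : ℂ)
      = (-1) ^ k * 2 ^ (2 * k + 1)
        * ((2 ^ (2 * (p + 1 - k)) - 1) / (Real.pi : ℂ) ^ (2 * (p + 1 - k)))
        * riemannZeta ((2 * (p + 1 - k) : ℕ) : ℂ) := by
  -- With `0 ^ 0 = 1` this covers both values at the origin.
  have hpen0 : ∀ q j : ℕ, penaltySymbol q j 0 = (-1) ^ j * 0 ^ j := fun q j => by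
    rw [penaltySymbol, massSymbol_zero_right, Real.cos_zero]
    norm_num
  refine ⟨?_, fun θ hθ => ?_, fun θ hθ => massSymbol_zero_left hθ, fun θ hθ h0 => ⟨?_, ?_⟩,
    ?_, ?_, fun h => ?_, penaltySymbol_pi p k, ?_⟩
  · exact contDiff_cardinalBSpline_succ_of_le (Nat.mul_le_mul_left 2 hk)
  · rw [← splineSymbol_eq_penaltySymbol hk hθ, splineSymbol_eq_cosine_sum hk θ]
    simp only [centeredDeriv, add_zero, ← sub_eq_add_neg]
  · exact summable_periodizedInvPow_of_mem_Icc (by lia) hθ h0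
  · rw [explicit_eq_mul_massSymbolExpr hk, penaltySymbol, massSymbol_of_ne_zero _ h0]
  · simp only [explicit_eq_mul_massSymbolExpr hk]
    have hc : Continuous fun θ : ℝ => (-1 : ℝ) ^ k * (2 - 2 * Real.cos θ) ^ k := by fun_prop
    have ht := ((hc.tendsto 0).mono_left (nhdsWithin_le_nhds (s := {0}ᶜ))).mul
      (tendsto_massSymbolExpr (p - k))
    rwa [penaltySymbol, massSymbol_zero_right]
  · simp [hpen0]
  · rw [hpen0, zero_pow (by lia), mul_zero]
  · rw [penaltySymbol_pi, Complex.ofReal_mul, massSymbol_pi, two_mul_add_one_tsub hk]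
    push_cast
    ring
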